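/- Let $(\Omega,\mathcal F,\mathbb P)$ be a probability space and $\mathbb X=(X_n)_{n\ge1}$ a strictly stationary sequence of real random variables on it. Let $\mathcal I^{\mathbb X}$ be the $\sigma$-field of all sets $A\subseteq\Omega$ for which there is a Borel set $B\subseteq\mathbb R^{\mathbb N}$ with $A=\{\omega:(X_i(\omega),X_{i+1}(\omega),\dots)\in B\}$ for every $i\ge1$. Let $\gamma=\gamma_1(X_1\mid\mathcal I^{\mathbb X})$ be (any version of) the conditional right endpoint of the support of $X_1$ given $\mathcal I^{\mathbb X}$, that is, an $\mathcal I^{\mathbb X}$-measurable function $\gamma:\Omega\to[-\infty,\infty]$ such that $\mathbb P(X_1\le\gamma\mid\mathcal I^{\mathbb X})=1$ a.s. and such that $\gamma\le\gamma'$ a.s. for every $\mathcal I^{\mathbb X}$-measurable $\gamma':\Omega\to[-\infty,\infty]$ with $\mathbb P(X_1\le\gamma'\mid\mathcal I^{\mathbb X})=1$ a.s. Let $a>0$, and let $(k_n)_{n\ge1}$ be integers with $1\le k_n\le n$ for all $n$ and $k_n/n\to1$. Put $$K(k_n,n,a)=\#\{1\le i\le n:\ X_{k_n:n}-a<X_i<X_{k_n:n}\},$$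 where $X_{1:n}\le\dots\le X_{n:n}$ are the order statistics of $X_1,\dots,X_n$. (i) If $\mathbb P(X_1=\gamma)=0$ and $\mathbb P(X_1=\gamma-a)=0$, then, almost surely, as $n\to\infty$, $$\frac{K(k_n,n,a)}n\longrightarrow I(\gamma<\infty)\cdot\mathbb P\bigl(X_1>\gamma-a\mid\mathcal I^{\mathbb X}\bigr).$$ In particular, for $\mathbb P$-almost every $\omega$ with $\gamma(\omega)=\infty$, $K(k_n,n,a)(\omega)/n\to0$. (ii) If $\gamma=\infty$ almost surely, then $K(k_n,n,a)/n\to0$ almost surely (without the two conditions in (i)). -/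

import Mathlib

open MeasureTheory ProbabilityTheory Filter Topology

noncomputable section

namespace NearMax

/-- A sequence of real random variables (`X 0` is the first one) is strictly stationary if the law
on `ℝ^ℕ` of every time-shifted sequence is the law of the sequence itself. -/
def StrictlyStationary {Ω : Type*} [MeasurableSpace Ω] (P : Measure Ω) (X : ℕ → Ω → ℝ) : Prop :=
  ∀ h : ℕ, IdentDistrib (fun ω (i : ℕ) => X (i + h) ω) (fun ω (i : ℕ) => X i ω) P P

/-- The sigma-field of the events that are invariant with respect to the sequence `X`: the sets `A`
for which there is one Borel set `B` of `ℝ^ℕ` with `A = {ω | (X_i(ω), X_{i+1}(ω), …) ∈ B}` for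
every `i`. -/
@[reducible] def invariantSigma {Ω : Type*} (X : ℕ → Ω → ℝ) : MeasurableSpace Ω where
  MeasurableSet' A := ∃ B : Set (ℕ → ℝ), MeasurableSet B ∧
    ∀ i : ℕ, A = {ω | (fun j : ℕ => X (i + j) ω) ∈ B}
  measurableSet_empty := ⟨∅, MeasurableSet.empty, fun i => by simp⟩
  measurableSet_compl := by
    rintro A ⟨B, hB, h⟩
    refine ⟨Bᶜ, hB.compl, fun i => ?_⟩
    rw [h i]
    rfl
  measurableSet_iUnion := by
    intro f hf
    choose B hB h using hf
    refine ⟨⋃ n, B n, MeasurableSet.iUnion hB, fun i => ?_⟩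
    ext ω
    simp only [Set.mem_iUnion, Set.mem_ofPred_eq]
    refine exists_congr fun n => ?_
    rw [h n i]
    rfl

lemma invariantSigma_le {Ω : Type*} [mΩ : MeasurableSpace Ω] {X : ℕ → Ω → ℝ}
    (hX : ∀ i, Measurable (X i)) : invariantSigma X ≤ mΩ := by
  rintro A ⟨B, hB, h⟩
  rw [h 0]
  exact (measurable_pi_lambda _ fun j => hX (0 + j)) hB

/-- The extended random variable `Q` is (a version of) the conditional right endpoint of the support
of `X` given the sigma-field `G`. -/
structure IsCondRightEndpoint {Ω : Type*} (G : MeasurableSpace Ω) [MeasurableSpace Ω]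
    (P : Measure Ω) (X : Ω → ℝ) (Q : Ω → EReal) : Prop where
  measurable : Measurable[G] Q
  condProb_eq_one : P⟦{ω | (X ω : EReal) ≤ Q ω} | G⟧ =ᵐ[P] fun _ => (1 : ℝ)
  le_of_condProb_eq_one : ∀ Q' : Ω → EReal, Measurable[G] Q' →
    (P⟦{ω | (X ω : EReal) ≤ Q' ω} | G⟧ =ᵐ[P] fun _ => (1 : ℝ)) → Q ≤ᵐ[P] Q'

/-- The `k`-th smallest of the first `n` terms `x 0, …, x (n - 1)` of a sequence, for `1 ≤ k ≤ n`
(the value for other `k` is irrelevant). -/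
def orderStat (x : ℕ → ℝ) (k n : ℕ) : ℝ :=
  if h : 1 ≤ k ∧ k ≤ n then
    (fun i : Fin n => x i) (Tuple.sort (fun i : Fin n => x i) ⟨k - 1, by omega⟩)
  else 0

/-- The number of those among the first `n` terms of a sequence that lie in the open interval
of length `a` to the left of the `k`-th order statistic of these `n` terms. -/
def nearCount (x : ℕ → ℝ) (k n : ℕ) (a : ℝ) : ℕ :=
  ((Finset.range n).filter fun i => orderStat x k n - a < x i ∧ x i < orderStat x k n).card

/-- For an event, to have conditional probability one means to be almost sure. -/
lemma condProb_eq_one_iff {Ω : Type*} {G : MeasurableSpace Ω} [mΩ : MeasurableSpace Ω] (P : Measure Ω)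
    [IsProbabilityMeasure P] (hG : G ≤ mΩ) {A : Set Ω}
    (hA : MeasurableSet A) :
    (P⟦A | G⟧ =ᵐ[P] fun _ => (1 : ℝ)) ↔ ∀ᵐ ω ∂P, ω ∈ A := by
  constructor
  · intro h
    have h1 : ∫ ω, (P⟦A | G⟧) ω ∂P = 1 := by
      rw [integral_congr_ae h]; simp
    rw [integral_condExp hG, integral_indicator_const (1 : ℝ) hA] at h1
    have h2 : P.real A = 1 := by simpa using h1
    have h3 : P A = 1 := by simpa [measureReal_def, ENNReal.toReal_eq_one_iff] using h2
    exact (mem_ae_iff_prob_eq_one hA).mpr h3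
  · intro h
    have h1 : A.indicator (fun _ => (1 : ℝ)) =ᵐ[P] fun _ => (1 : ℝ) := by
      filter_upwards [h] with ω hω
      simp [hω]
    refine (condExp_congr_ae h1).trans ?_
    rw [condExp_const hG]

/-- Every random variable has a conditional right endpoint given any sub-sigma-field. -/
theorem exists_isCondRightEndpoint {Ω : Type*} {G : MeasurableSpace Ω} [mΩ : MeasurableSpace Ω]
    (P : Measure Ω) [IsProbabilityMeasure P] {X : Ω → ℝ} (hX : Measurable X) (hG : G ≤ mΩ) : ∃ Q : Ω → EReal, IsCondRightEndpoint G P X Q := by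
  classical
  let f : ℚ → Ω → ℝ := fun q => P⟦{ω | (q : ℝ) < X ω} | G⟧
  have hf : ∀ q, Measurable[G] (f q) := fun q => stronglyMeasurable_condExp.measurable
  have hE : ∀ q, MeasurableSet[G] {ω | f q ω = 0} := fun q => (hf q) (measurableSet_singleton 0)
  have hXq : ∀ q : ℚ, MeasurableSet {ω | (q : ℝ) < X ω} := fun q => measurableSet_lt measurable_const hX
  have hint : ∀ q : ℚ, Integrable ({ω | (q : ℝ) < X ω}.indicator fun _ => (1 : ℝ)) P :=
    fun q => (integrable_const _).indicator (hXq q)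
  have key : ∀ (q : ℚ) (s : Set Ω), MeasurableSet[G] s →
      ∫ ω in s, f q ω ∂P = P.real ({ω | (q : ℝ) < X ω} ∩ s) := by
    intro q s hs
    rw [setIntegral_condExp hG (hint q) hs, integral_indicator_const (1 : ℝ) (hXq q)]
    simp [measureReal_restrict_apply (hXq q)]
  have hmeas : ∀ Q' : Ω → EReal, Measurable[G] Q' → MeasurableSet {ω | (X ω : EReal) ≤ Q' ω} :=
    fun Q' hQ' => measurableSet_le hX.coe_real_ereal (hQ'.mono hG le_rfl)
  let Q : Ω → EReal := fun ω => ⨅ q : ℚ, if f q ω = 0 then ((q : ℝ) : EReal) else ⊤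
  have hQ : Measurable[G] Q :=
    Measurable.iInf fun q => Measurable.ite (hE q) measurable_const measurable_const
  refine ⟨Q, hQ, ?_, ?_⟩
  · rw [condProb_eq_one_iff P hG (hmeas Q hQ)]
    have h : ∀ q : ℚ, ∀ᵐ ω ∂P, f q ω = 0 → X ω ≤ q := by
      intro q
      have h0 : P.real ({ω | (q : ℝ) < X ω} ∩ {ω | f q ω = 0}) = 0 := by
        rw [← key q _ (hE q)]
        exact setIntegral_eq_zero_of_forall_eq_zero fun ω hω => hω
      rw [measureReal_eq_zero_iff] at h0
      have h1 := measure_eq_zero_iff_ae_notMem.mp h0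
      filter_upwards [h1] with ω hω h2
      by_contra h3
      exact hω ⟨not_le.mp h3, h2⟩
    filter_upwards [ae_all_iff.mpr h] with ω hω
    refine le_iInf fun q => ?_
    split_ifs with h2
    · exact_mod_cast hω q h2
    · exact le_top
  · intro Q' hQ' h
    rw [condProb_eq_one_iff P hG (hmeas Q' hQ')] at h
    have h' : ∀ q : ℚ, ∀ᵐ ω ∂P, Q' ω ≤ ((q : ℝ) : EReal) → f q ω = 0 := by
      intro q
      have hs : MeasurableSet[G] {ω | Q' ω ≤ ((q : ℝ) : EReal)} := hQ' measurableSet_Iic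
      have h0 : ∫ ω in {ω | Q' ω ≤ ((q : ℝ) : EReal)}, f q ω ∂P = 0 := by
        rw [key q _ hs, measureReal_eq_zero_iff, measure_eq_zero_iff_ae_notMem]
        filter_upwards [h] with ω hω h2
        have h3 : ((q : ℝ) : EReal) < X ω := by exact_mod_cast h2.1
        exact absurd (h3.trans_le (hω.trans h2.2)) (lt_irrefl _)
      have hnn : 0 ≤ᵐ[P] f q := condExp_nonneg (Eventually.of_forall fun ω =>
        Set.indicator_nonneg (fun _ _ => zero_le_one) ω)
      rw [setIntegral_eq_zero_iff_of_nonneg_ae (ae_restrict_of_ae hnn)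
        integrable_condExp.integrableOn] at h0
      exact (ae_restrict_iff' (hG _ hs)).mp h0
    filter_upwards [ae_all_iff.mpr h'] with ω hω
    by_contra hlt
    obtain ⟨q, hq1, hq2⟩ := EReal.lt_iff_exists_rat_btwn.mp (not_le.mp hlt)
    refine absurd hq2 (not_lt.mpr ?_)
    refine (iInf_le _ q).trans ?_
    rw [if_pos (hω q hq1.le)]

end NearMax

end

/-! The variable `γ` is a shift-invariant function of the path, so it is constant along each orbit.
The pointwise ergodic theorem on path space then shows that, almost surely, the frequency of visits
of `(γ, X i)` to a Borel set tends to the conditional probability that `(γ, X 0)` lies in it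
(`ae_tendsto_frequency`). The ergodic theorem itself is derived, for bounded functions, from the
maximal ergodic lemma.

By minimality of `γ`, each level below `γ` is exceeded with positive conditional probability
(`IsCondRightEndpoint.ae_condProb_pos`), hence with positive limiting frequency. Since `k n / n →
1`, only a vanishing proportion of the sample lies above the order statistic, which therefore
eventually passes every such level (`ae_eventually_lt_orderStat`).

Where `γ = ⊤`, the window of length `a` climbs above every level `m`, and the limiting frequency of
exceeding `m` becomes arbitrarily small as `m` grows. Where `γ` is finite, the order statistic
increases to within any distance of `γ` and never exceeds it. Membership in the window then differs
from exceeding `γ - a` only for terms just below `γ - a` or just below `γ`. The absence of atoms at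
these two points makes such terms rare (`ae_window_freq`). -/

noncomputable section

namespace NearMax

/-! ### The maximal ergodic lemma and the pointwise ergodic theorem for bounded functions. -/

section Birkhoff

variable {S : Type*} {T : S → S}

/-- The maximum of `0` and the first `n` Birkhoff sums of `g`. -/
def birkhoffMax (T : S → S) (g : S → ℝ) : ℕ → S → ℝ
  | 0 => fun _ => 0
  | n + 1 => fun x => max 0 (g x + birkhoffMax T g n (T x))

lemma birkhoffMax_nonneg (g : S → ℝ) (n : ℕ) (x : S) : 0 ≤ birkhoffMax T g n x := by
  cases n with
  | zero => exact le_rfl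
  | succ n => exact le_max_left _ _

lemma birkhoffMax_le_succ (g : S → ℝ) (n : ℕ) (x : S) :
    birkhoffMax T g n x ≤ birkhoffMax T g (n + 1) x := by
  induction n generalizing x with
  | zero => exact birkhoffMax_nonneg g 1 x
  | succ n ih => exact max_le_max le_rfl (add_le_add le_rfl (ih (T x)))

lemma birkhoffSum_le_birkhoffMax (g : S → ℝ) (n : ℕ) (x : S) :
    birkhoffSum T g n x ≤ birkhoffMax T g n x := by
  induction n generalizing x with
  | zero => simp [birkhoffMax]
  | succ n ih =>
    rw [birkhoffSum_succ']
    exact (add_le_add le_rfl (ih (T x))).trans (le_max_right _ _)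

lemma birkhoffSum_sub_const_of_invariant {f h : S → ℝ} (hh : ∀ x, h (T x) = h x) (ε : ℝ) (n : ℕ)
    (x : S) : birkhoffSum T (fun y => f y - h y - ε) n x
      = birkhoffSum T f n x - n * (h x + ε) := by
  induction n generalizing x with
  | zero => simp
  | succ n ih =>
    rw [birkhoffSum_succ', birkhoffSum_succ', ih (T x), hh]
    push_cast; ring

variable [MeasurableSpace S] {μ : Measure S}

lemma measurable_birkhoffMax (hT : Measurable T) {g : S → ℝ} (hg : Measurable g) (n : ℕ) :
    Measurable (birkhoffMax T g n) := by
  induction n with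
  | zero => exact measurable_const
  | succ n ih => exact measurable_const.max (hg.add (ih.comp hT))

lemma integrable_birkhoffMax (hT : MeasurePreserving T μ μ) {g : S → ℝ} (hg : Integrable g μ)
    (n : ℕ) : Integrable (birkhoffMax T g n) μ := by
  induction n with
  | zero => exact integrable_zero _ _ _
  | succ n ih =>
    have h : Integrable (fun x => birkhoffMax T g n (T x)) μ :=
      (hT.integrable_comp ih.aestronglyMeasurable).mpr ih
    exact (integrable_zero S ℝ μ).sup (hg.add h)

/-- The maximal ergodic lemma. -/
lemma setIntegral_birkhoffMax_pos_nonneg (hT : MeasurePreserving T μ μ) {g : S → ℝ}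
    (hgm : Measurable g) (hg : Integrable g μ) (n : ℕ) :
    0 ≤ ∫ x in {x | 0 < birkhoffMax T g n x}, g x ∂μ := by
  cases n with
  | zero => simp [birkhoffMax]
  | succ n =>
    set E := {x | 0 < birkhoffMax T g (n + 1) x}
    have hE : MeasurableSet E :=
      measurableSet_lt measurable_const (measurable_birkhoffMax hT.measurable hgm _)
    have hi := integrable_birkhoffMax hT hg n
    have hi' := integrable_birkhoffMax hT hg (n + 1)
    have hiT : Integrable (fun x => birkhoffMax T g n (T x)) μ :=
      (hT.integrable_comp hi.aestronglyMeasurable).mpr hi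
    -- Garsia's argument: on `E` the maximum is attained by its second entry, so `g` is the
    -- difference of the new maximum and the old one composed with `T`. The new maximum vanishes off
    -- `E`, and invariance of `μ` removes `T` from the old one.
    have h1 : ∫ x in E, g x ∂μ
        = ∫ x in E, birkhoffMax T g (n + 1) x ∂μ - ∫ x in E, birkhoffMax T g n (T x) ∂μ := by
      rw [← integral_sub hi'.integrableOn hiT.integrableOn]
      refine setIntegral_congr_fun hE fun x hx => ?_
      have hx' : 0 < max 0 (g x + birkhoffMax T g n (T x)) := hx
      have : birkhoffMax T g (n + 1) x = g x + birkhoffMax T g n (T x) :=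
        max_eq_right ((lt_max_iff.mp hx').resolve_left (lt_irrefl _)).le
      simp only [this]; ring
    have h2 : ∫ x in E, birkhoffMax T g (n + 1) x ∂μ = ∫ x, birkhoffMax T g (n + 1) x ∂μ := by
      refine setIntegral_eq_integral_of_forall_compl_eq_zero fun x hx => ?_
      exact le_antisymm (not_lt.mp hx) (birkhoffMax_nonneg _ _ _)
    have h3 : ∫ x in E, birkhoffMax T g n (T x) ∂μ ≤ ∫ x, birkhoffMax T g n (T x) ∂μ :=
      setIntegral_le_integral hiT (Eventually.of_forall fun x => birkhoffMax_nonneg _ _ _)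
    have h4 : ∫ x, birkhoffMax T g n (T x) ∂μ = ∫ x, birkhoffMax T g n x ∂μ := by
      have := integral_map (μ := μ) hT.measurable.aemeasurable
        (f := birkhoffMax T g n) (by rw [hT.map_eq]; exact hi.aestronglyMeasurable)
      rw [hT.map_eq] at this
      exact this.symm
    have h5 : ∫ x, birkhoffMax T g n x ∂μ ≤ ∫ x, birkhoffMax T g (n + 1) x ∂μ :=
      integral_mono hi hi' fun x => birkhoffMax_le_succ g n x
    linarith

/-- If some Birkhoff sum of `g` is positive at each point of an invariant set, then the integral of
`g` over this set is nonnegative. -/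
lemma setIntegral_nonneg_of_birkhoffSum_pos (hT : MeasurePreserving T μ μ) {g : S → ℝ}
    (hgm : Measurable g) (hg : Integrable g μ) {D : Set S} (hD : MeasurableSet D)
    (hinv : T ⁻¹' D = D) (hpos : ∀ x ∈ D, ∃ n, 0 < birkhoffSum T g n x) :
    0 ≤ ∫ x in D, g x ∂μ := by
  have hinv' : ∀ x, T x ∈ D ↔ x ∈ D := fun x => by rw [← Set.mem_preimage, hinv]
  -- Cutting `g` off outside the invariant set `D` leaves the Birkhoff sums on `D` unchanged and
  -- makes the maxima vanish off `D`. The sets where these maxima are positive therefore increase to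
  -- exactly `D`.
  have hgD : Measurable (D.indicator g) := hgm.indicator hD
  have hout : ∀ n, ∀ x ∉ D, birkhoffMax T (D.indicator g) n x = 0 := by
    intro n
    induction n with
    | zero => intro x _; rfl
    | succ n ih =>
      intro x hx
      simp [birkhoffMax, hx, ih (T x) (by rwa [hinv'])]
  have hsum : ∀ n, ∀ x ∈ D, birkhoffSum T (D.indicator g) n x = birkhoffSum T g n x := by
    intro n
    induction n with
    | zero => intro x _; simp
    | succ n ih =>
      intro x hx
      rw [birkhoffSum_succ', birkhoffSum_succ', ih (T x) ((hinv' x).mpr hx),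
        Set.indicator_of_mem hx]
  set E : ℕ → Set S := fun n => {x | 0 < birkhoffMax T (D.indicator g) n x}
  have hE : ∀ n, MeasurableSet (E n) := fun n =>
    measurableSet_lt measurable_const (measurable_birkhoffMax hT.measurable hgD _)
  have hmono : Monotone E := monotone_nat_of_le_succ fun n x hx =>
    lt_of_lt_of_le hx (birkhoffMax_le_succ _ n x)
  have hU : ⋃ n, E n = D := by
    ext x
    simp only [Set.mem_iUnion]
    constructor
    · rintro ⟨n, hn⟩
      by_contra hx
      exact (hout n x hx).not_gt hn
    · intro hx
      obtain ⟨n, hn⟩ := hpos x hx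
      refine ⟨n, ?_⟩
      rw [← hsum n x hx] at hn
      exact hn.trans_le (birkhoffSum_le_birkhoffMax _ n x)
  have hlim := tendsto_setIntegral_of_monotone (μ := μ) (f := D.indicator g) hE hmono
    (hg.indicator hD).integrableOn
  rw [hU] at hlim
  have := ge_of_tendsto' hlim fun n =>
    setIntegral_birkhoffMax_pos_nonneg hT hgD (hg.indicator hD) n
  rwa [setIntegral_indicator hD, Set.inter_self] at this

lemma measurable_birkhoffAverage (hT : Measurable T) {f : S → ℝ} (hf : Measurable f) (n : ℕ) :
    Measurable (birkhoffAverage ℝ T f n) := by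
  exact (Finset.measurable_sum (Finset.range n) fun k _ => hf.comp (hT.iterate k)).const_mul
    (n : ℝ)⁻¹

/-- Upper half of the pointwise ergodic theorem for bounded functions. -/
lemma ae_eventually_birkhoffAverage_le [IsFiniteMeasure μ] (hT : MeasurePreserving T μ μ)
    {f : S → ℝ} (hf : Measurable f) {C : ℝ} (hC : ∀ x, |f x| ≤ C) {ε : ℝ} (hε : 0 < ε) :
    ∀ᵐ x ∂μ, ∀ᶠ n : ℕ in atTop,
      birkhoffAverage ℝ T f n x ≤ (μ[f|MeasurableSpace.invariants T]) x + ε := by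
  set h := μ[f|MeasurableSpace.invariants T] with hh
  have hle := MeasurableSpace.invariants_le T
  have hhI : Measurable[MeasurableSpace.invariants T] h :=
    stronglyMeasurable_condExp.measurable
  have hhm : Measurable h := hhI.mono hle le_rfl
  have hhT : ∀ x, h (T x) = h x := fun x =>
    congrFun (MeasurableSpace.comp_eq_of_measurable_invariants hhI) x
  have hfi : Integrable f μ := Integrable.of_bound hf.aestronglyMeasurable C
    (Eventually.of_forall fun x => by simpa using hC x)
  -- `D` says that the upper limit of the averages exceeds `h + ε / 2`. Rational levels strictly
  -- above `ε / 2` give measurability as well as room to lower the level. That room makes `D`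
  -- exactly invariant, since for bounded `f` the averages at `x` and `T x` differ by a null
  -- sequence.
  set D : Set S := {x | ∃ δ : ℚ, ε / 2 < δ ∧
    ∃ᶠ n : ℕ in atTop, (δ : ℝ) < birkhoffAverage ℝ T f n x - h x} with hDdef
  have hD : MeasurableSet D := by
    have : D = ⋃ δ : ℚ, ⋃ _ : ε / 2 < δ, ⋂ N : ℕ, ⋃ n : ℕ, ⋃ _ : N ≤ n,
        {x | (δ : ℝ) < birkhoffAverage ℝ T f n x - h x} := by
      ext x
      simp [hDdef, frequently_atTop]
    rw [this]
    exact MeasurableSet.iUnion fun δ => MeasurableSet.iUnion fun _ => MeasurableSet.iInter fun N =>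
      MeasurableSet.iUnion fun n => MeasurableSet.iUnion fun _ =>
        measurableSet_lt measurable_const ((measurable_birkhoffAverage hT.measurable hf n).sub hhm)
  have hdiff : ∀ x, Tendsto (fun n ↦ birkhoffAverage ℝ T f n (T x) - birkhoffAverage ℝ T f n x)
      atTop (𝓝 0) := fun x =>
    tendsto_birkhoffAverage_apply_sub_birkhoffAverage' ℝ
      (isBounded_iff_forall_norm_le.mpr ⟨C, by rintro _ ⟨y, rfl⟩; simpa using hC y⟩) T x
  have hstep : ∀ x y, h x = h y →
      Tendsto (fun n ↦ birkhoffAverage ℝ T f n x - birkhoffAverage ℝ T f n y) atTop (𝓝 0) →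
      x ∈ D → y ∈ D := by
    rintro x y hxy hlim ⟨δ, hδ, hfreq⟩
    obtain ⟨δ', h1, h2⟩ := exists_rat_btwn hδ
    refine ⟨δ', h1, ?_⟩
    have hev := hlim.eventually_lt_const (sub_pos.mpr h2)
    refine (hfreq.and_eventually hev).mono fun n hn => ?_
    linarith [hn.1, hn.2]
  have hinv : T ⁻¹' D = D := by
    ext x
    refine ⟨hstep _ _ (hhT x) (hdiff x), hstep _ _ (hhT x).symm ?_⟩
    simpa using (hdiff x).neg
  have hDI : MeasurableSet[MeasurableSpace.invariants T] D :=
    MeasurableSpace.measurableSet_invariants.mpr ⟨hD, hinv⟩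
  have hgi : Integrable (fun y => f y - h y - ε / 2) μ :=
    (hfi.sub integrable_condExp).sub (integrable_const _)
  have hnn : 0 ≤ ∫ x in D, (f x - h x - ε / 2) ∂μ := by
    refine setIntegral_nonneg_of_birkhoffSum_pos (g := fun x => f x - h x - ε / 2) hT
      ((hf.sub hhm).sub measurable_const) hgi hD hinv ?_
    rintro x ⟨δ, hδ, hfreq⟩
    obtain ⟨n, hn, hn0⟩ := (hfreq.and_eventually (eventually_gt_atTop 0)).exists
    refine ⟨n, ?_⟩
    have hn0' : (0 : ℝ) < n := by exact_mod_cast hn0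
    rw [birkhoffSum_sub_const_of_invariant hhT, sub_pos]
    have h1 : h x + ε / 2 < (n : ℝ)⁻¹ * birkhoffSum T f n x := by
      have : birkhoffAverage ℝ T f n x = (n : ℝ)⁻¹ * birkhoffSum T f n x := rfl
      linarith
    rwa [inv_mul_eq_div, lt_div_iff₀ hn0', mul_comm] at h1
  -- Over the invariant set `D` the integrals of `f` and of its conditional expectation `h` agree,
  -- so the nonnegative integral in `hnn` equals `-(ε / 2) * μ.real D`.
  have hzero : μ.real D = 0 := by
    have h1 : ∫ x in D, (f x - h x - ε / 2) ∂μ = - (ε / 2 * μ.real D) := by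
      have h2 : ∫ x in D, (f x - h x) ∂μ = 0 := by
        rw [integral_sub hfi.integrableOn integrable_condExp.integrableOn,
          setIntegral_condExp hle hfi hDI, sub_self]
      have h3 : IntegrableOn (fun x => f x - h x) D μ := (hfi.sub integrable_condExp).integrableOn
      rw [integral_sub h3 (integrable_const _), h2]
      simp [mul_comm]
    have : 0 ≤ μ.real D := measureReal_nonneg
    nlinarith
  have hD0 := measure_eq_zero_iff_ae_notMem.mp ((measureReal_eq_zero_iff).mp hzero)
  filter_upwards [hD0] with x hx
  by_contra hcon
  obtain ⟨δ, h1, h2⟩ := exists_rat_btwn (half_lt_self hε)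
  refine hx ⟨δ, h1, (not_eventually.mp hcon).mono fun n hn => ?_⟩
  linarith [not_le.mp hn]

/-- The pointwise ergodic theorem for bounded functions. -/
theorem ae_tendsto_birkhoffAverage [IsFiniteMeasure μ] (hT : MeasurePreserving T μ μ)
    {f : S → ℝ} (hf : Measurable f) {C : ℝ} (hC : ∀ x, |f x| ≤ C) :
    ∀ᵐ x ∂μ, Tendsto (fun n => birkhoffAverage ℝ T f n x) atTop
      (𝓝 ((μ[f|MeasurableSpace.invariants T]) x)) := by
  have hpos : ∀ j : ℕ, (0 : ℝ) < 1 / ((j : ℝ) + 1) := fun j => by positivity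
  have h1 := ae_all_iff.mpr fun j : ℕ => ae_eventually_birkhoffAverage_le hT hf hC (hpos j)
  have h2 := ae_all_iff.mpr fun j : ℕ =>
    ae_eventually_birkhoffAverage_le hT hf.neg (C := C) (fun x => by simpa using hC x) (hpos j)
  filter_upwards [h1, h2, condExp_neg f (MeasurableSpace.invariants T) (μ := μ)] with x h1 h2 h3
  rw [Metric.tendsto_nhds]
  intro ε hε
  obtain ⟨j, hj⟩ := exists_nat_one_div_lt hε
  filter_upwards [h1 j, h2 j] with n hn1 hn2
  have h4 : birkhoffAverage ℝ T (-f) n x = - birkhoffAverage ℝ T f n x := by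
    simp [birkhoffAverage, birkhoffSum]
  rw [h4, h3, Pi.neg_apply] at hn2
  rw [Real.dist_eq, abs_lt]
  constructor <;> linarith

end Birkhoff

/-! ### Path space, the shift, and the invariant sigma-field. -/

/-- Conditional expectations commute with pulling back along a measurable map. -/
lemma condExp_map_comp_ae_eq {Ω S : Type*} {m : MeasurableSpace S} [mΩ : MeasurableSpace Ω]
    [mS : MeasurableSpace S] {P : Measure Ω} [IsFiniteMeasure P] {Y : Ω → S} (hY : Measurable Y)
    (hm : m ≤ mS) {f : S → ℝ} (hf : Integrable f (P.map Y)) :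
    (fun ω => ((P.map Y)[f|m]) (Y ω)) =ᵐ[P] P[fun ω => f (Y ω)|m.comap Y] := by
  have hle : m.comap Y ≤ mΩ := (MeasurableSpace.comap_mono hm).trans hY.comap_le
  have hi : Integrable (fun ω => ((P.map Y)[f|m]) (Y ω)) P :=
    (integrable_map_measure integrable_condExp.aestronglyMeasurable hY.aemeasurable).mp
      integrable_condExp
  have hif : Integrable (fun ω => f (Y ω)) P :=
    (integrable_map_measure hf.aestronglyMeasurable hY.aemeasurable).mp hf
  refine ae_eq_condExp_of_forall_setIntegral_eq hle hif (fun _ _ _ => hi.integrableOn) ?_ ?_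
  · rintro _ ⟨B, hB, rfl⟩ -
    rw [← setIntegral_map (hm _ hB) integrable_condExp.aestronglyMeasurable hY.aemeasurable,
      ← setIntegral_map (hm _ hB) hf.aestronglyMeasurable hY.aemeasurable,
      setIntegral_condExp hm hf hB]
  · exact (stronglyMeasurable_condExp.comp_measurable
      (comap_measurable Y)).aestronglyMeasurable

/-- The shift on the space of real sequences. -/
def shift (x : ℕ → ℝ) : ℕ → ℝ := fun i => x (i + 1)

lemma measurable_shift : Measurable shift :=
  measurable_pi_lambda _ fun i => measurable_pi_apply (i + 1)

lemma shift_iterate (n : ℕ) (x : ℕ → ℝ) : shift^[n] x = fun j => x (n + j) := by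
  induction n generalizing x with
  | zero => simp
  | succ n ih =>
    rw [Function.iterate_succ_apply, ih]
    funext j
    simp only [shift]
    congr 1; omega

section Path

variable {Ω : Type*} {X : ℕ → Ω → ℝ}

/-- The path of a sequence of random variables. -/
def path (X : ℕ → Ω → ℝ) (ω : Ω) : ℕ → ℝ := fun i => X i ω

/-- This identification lets the ergodic theorem, whose limit is conditioned on shift-invariant sets
of paths, be read as a statement about conditioning on `invariantSigma X`. -/
lemma invariantSigma_eq_comap (X : ℕ → Ω → ℝ) :
    invariantSigma X = (MeasurableSpace.invariants shift).comap (path X) := by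
  have hpath : ∀ i ω, shift^[i] (path X ω) = fun j => X (i + j) ω := fun i ω => by
    rw [shift_iterate]; rfl
  refine le_antisymm ?_ ?_
  · rintro A ⟨B, hB, h⟩
    have h' : ∀ ω i, shift^[i] (path X ω) ∈ B ↔ ω ∈ A := fun ω i => by
      rw [hpath]; conv_rhs => rw [h i]
      rfl
    -- The set `B` need not be shift-invariant off the range of the path map. The set of sequences
    -- whose orbit visits `B` infinitely often is invariant, and it has the same preimage because,
    -- along a path, membership in `B` does not depend on the time.
    refine ⟨{x | ∃ᶠ n : ℕ in atTop, shift^[n] x ∈ B}, ⟨?_, ?_⟩, ?_⟩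
    · have : {x | ∃ᶠ n : ℕ in atTop, shift^[n] x ∈ B}
          = ⋂ N : ℕ, ⋃ n : ℕ, ⋃ _ : N ≤ n, shift^[n] ⁻¹' B := by
        ext x
        simp [frequently_atTop]
      rw [this]
      exact MeasurableSet.iInter fun N => MeasurableSet.iUnion fun n => MeasurableSet.iUnion
        fun _ => (measurable_shift.iterate n) hB
    · ext x
      change (∃ᶠ n : ℕ in atTop, shift^[n + 1] x ∈ B) ↔ _
      conv_rhs => rw [Set.mem_ofPred_eq, ← Filter.map_add_atTop_eq_nat 1]
      rw [Filter.frequently_map]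
    · ext ω
      simp [h']
  · rintro _ ⟨B, ⟨hB, hinv⟩, rfl⟩
    refine ⟨B, hB, fun i => ?_⟩
    ext ω
    have h : shift^[i] ⁻¹' B = B :=
      (MeasurableSpace.le_invariants_iterate shift i B ⟨hB, hinv⟩).2
    rw [Set.mem_ofPred_eq, ← hpath, ← Set.mem_preimage, h]
    rfl

/-- A function that is measurable with respect to the invariant sigma-field is a shift-invariant
function of the path. -/
lemma exists_invariant_factor {Z : Type*} [Nonempty Z] [MeasurableSpace Z] [StandardBorelSpace Z]
    {γ : Ω → Z} (hγ : Measurable[invariantSigma X] γ) :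
    ∃ g : (ℕ → ℝ) → Z, Measurable g ∧ (∀ n x, g (shift^[n] x) = g x) ∧ ∀ ω, γ ω = g (path X ω) := by
  rw [invariantSigma_eq_comap] at hγ
  obtain ⟨g, hg, rfl⟩ := Measurable.exists_eq_measurable_comp
    (mY := MeasurableSpace.invariants shift) hγ
  have h1 := MeasurableSpace.comp_eq_of_measurable_invariants hg
  refine ⟨g, hg.mono (MeasurableSpace.invariants_le _) le_rfl, fun n x => ?_, fun _ => rfl⟩
  induction n generalizing x with
  | zero => rfl
  | succ n ih => rw [Function.iterate_succ_apply, ih]; exact congrFun h1 x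

variable [MeasurableSpace Ω] {P : Measure Ω}

lemma measurable_path (hX : ∀ i, Measurable (X i)) : Measurable (path X) :=
  measurable_pi_lambda _ hX

lemma StrictlyStationary.measurePreserving_shift (hX : ∀ i, Measurable (X i))
    (hstat : StrictlyStationary P X) :
    MeasurePreserving shift (P.map (path X)) (P.map (path X)) := by
  refine ⟨measurable_shift, ?_⟩
  rw [Measure.map_map measurable_shift (measurable_path hX)]
  exact (hstat 1).map_eq

/-- Written through the path, the bound at time `i` is the bound at time `0` evaluated after `i`
shifts, because `γ` does not change under the shift; the shift preserves null sets. -/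
lemma ae_le_of_ae_zero_le (hX : ∀ i, Measurable (X i)) (hstat : StrictlyStationary P X)
    {γ : Ω → EReal} (hγ : Measurable[invariantSigma X] γ) (h0 : ∀ᵐ ω ∂P, (X 0 ω : EReal) ≤ γ ω) :
    ∀ᵐ ω ∂P, ∀ i, (X i ω : EReal) ≤ γ ω := by
  obtain ⟨g, hg, hginv, hγg⟩ := exists_invariant_factor hγ
  have hp := measurable_path hX
  have hS : MeasurableSet {x : ℕ → ℝ | (x 0 : EReal) ≤ g x} :=
    measurableSet_le (measurable_pi_apply 0).coe_real_ereal hg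
  have h1 : ∀ᵐ x ∂(P.map (path X)), (x 0 : EReal) ≤ g x := by
    rw [ae_map_iff hp.aemeasurable hS]
    filter_upwards [h0] with ω hω
    rw [← hγg]; exact hω
  refine ae_all_iff.mpr fun i => ?_
  have h2 := ((hstat.measurePreserving_shift hX).iterate i).quasiMeasurePreserving.ae h1
  filter_upwards [ae_of_ae_map hp.aemeasurable h2] with ω hω
  rw [hginv, ← hγg, shift_iterate] at hω
  exact hω

variable [IsProbabilityMeasure P]

open Classical in
/-- Ergodic theorem for the frequencies of visits of `(γ, X i)` to a Borel set, where `γ` is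
invariant. -/
lemma ae_tendsto_frequency (hX : ∀ i, Measurable (X i)) (hstat : StrictlyStationary P X)
    {γ : Ω → EReal} (hγ : Measurable[invariantSigma X] γ) {R : Set (EReal × ℝ)}
    (hR : MeasurableSet R) :
    ∀ᵐ ω ∂P, Tendsto
      (fun n : ℕ => (((Finset.range n).filter fun i => (γ ω, X i ω) ∈ R).card : ℝ) / (n : ℝ)) atTop
      (𝓝 ((P⟦{ω' | (γ ω', X 0 ω') ∈ R}|invariantSigma X⟧) ω)) := by
  obtain ⟨g, hg, hginv, hγg⟩ := exists_invariant_factor hγ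
  have hp := measurable_path hX
  have := Measure.isProbabilityMeasure_map (μ := P) hp.aemeasurable
  set A : Set (ℕ → ℝ) := {x | (g x, x 0) ∈ R}
  have hA : MeasurableSet A := (hg.prodMk (measurable_pi_apply 0)) hR
  set f : (ℕ → ℝ) → ℝ := A.indicator fun _ => 1
  have hf : Measurable f := measurable_const.indicator hA
  have hb : ∀ x, |f x| ≤ 1 := fun x => by
    by_cases hx : x ∈ A <;> simp [f, hx]
  have hfi : Integrable f (P.map (path X)) := (integrable_const _).indicator hA
  have h1 := ae_of_ae_map hp.aemeasurable
    (ae_tendsto_birkhoffAverage (hstat.measurePreserving_shift hX) hf hb)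
  have h2 := condExp_map_comp_ae_eq hp (MeasurableSpace.invariants_le shift) hfi
  rw [← invariantSigma_eq_comap] at h2
  have h3 : (fun ω => f (path X ω)) = {ω' | (γ ω', X 0 ω') ∈ R}.indicator fun _ => (1 : ℝ) := by
    funext ω
    simp only [f, Set.indicator, A, Set.mem_ofPred_eq, hγg]
    rfl
  rw [h3] at h2
  filter_upwards [h1, h2] with ω h1 h2
  rw [← h2]
  refine h1.congr fun n => ?_
  -- Invariance of `g` keeps the first coordinate equal to `γ ω` along the whole orbit.
  have hmem : ∀ i, shift^[i] (path X ω) ∈ A ↔ (γ ω, X i ω) ∈ R := fun i => by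
    simp only [A, Set.mem_ofPred_eq, hginv, ← hγg]
    rw [shift_iterate]; rfl
  have h4 : birkhoffSum shift f n (path X ω)
      = (((Finset.range n).filter fun i => (γ ω, X i ω) ∈ R).card : ℝ) := by
    rw [Finset.card_filter]
    push_cast
    refine Finset.sum_congr rfl fun i _ => ?_
    simp only [f, Set.indicator, hmem]
  rw [birkhoffAverage, h4, smul_eq_mul, inv_mul_eq_div]

end Path

/-! ### Conditional exceedance probabilities. -/

section CondProb

variable {Ω : Type*} {G : MeasurableSpace Ω} [mΩ : MeasurableSpace Ω] {P : Measure Ω}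
  [IsProbabilityMeasure P]

lemma setIntegral_condProb (hG : G ≤ mΩ) {A s : Set Ω} (hA : MeasurableSet A)
    (hs : MeasurableSet[G] s) : ∫ ω in s, (P⟦A|G⟧) ω ∂P = P.real (A ∩ s) := by
  rw [setIntegral_condExp hG ((integrable_const _).indicator hA) hs,
    integral_indicator_const (1 : ℝ) hA]
  simp [measureReal_restrict_apply hA]

/-- Below the conditional right endpoint, exceedances have positive conditional probability. -/
lemma IsCondRightEndpoint.ae_condProb_pos (hG : G ≤ mΩ) {Y : Ω → ℝ} (hY : Measurable Y)
    {γ : Ω → EReal} (hγ : IsCondRightEndpoint G P Y γ) (c : ℝ) :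
    ∀ᵐ ω ∂P, (c : EReal) < γ ω → 0 < (P⟦{ω' | c < Y ω'}|G⟧) ω := by
  set f := P⟦{ω' | c < Y ω'}|G⟧ with hf
  have hfm : Measurable[G] f := stronglyMeasurable_condExp.measurable
  have hA : MeasurableSet {ω' | c < Y ω'} := measurableSet_lt measurable_const hY
  classical
  -- On `s` the endpoint could be lowered to `c` without losing the almost sure bound on `Y`. The
  -- lowered function is `G`-measurable, so minimality of `γ` forces `s` to be null.
  set s : Set Ω := {ω | (c : EReal) < γ ω} ∩ {ω | f ω ≤ 0}
  have hs : MeasurableSet[G] s := (hγ.measurable measurableSet_Ioi).inter (hfm measurableSet_Iic)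
  have hle : ∀ {Q : Ω → EReal}, Measurable[G] Q → MeasurableSet {ω | (Y ω : EReal) ≤ Q ω} :=
    fun hQ => measurableSet_le hY.coe_real_ereal (hQ.mono hG le_rfl)
  have h0 := (condProb_eq_one_iff P hG (hle hγ.measurable)).mp hγ.condProb_eq_one
  have hQ : Measurable[G] (s.piecewise (fun _ => (c : EReal)) γ) :=
    Measurable.piecewise hs measurable_const hγ.measurable
  have h1 : P.real ({ω' | c < Y ω'} ∩ s) = 0 := by
    refine le_antisymm ?_ measureReal_nonneg
    rw [← setIntegral_condProb hG hA hs]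
    exact setIntegral_nonpos (hG _ hs) fun ω hω => hω.2
  have h2 := measure_eq_zero_iff_ae_notMem.mp ((measureReal_eq_zero_iff).mp h1)
  have h3 := hγ.le_of_condProb_eq_one _ hQ <| by
    rw [condProb_eq_one_iff P hG (hle hQ)]
    filter_upwards [h0, h2] with ω h0 h2
    by_cases hω : ω ∈ s
    · have : Y ω ≤ c := not_lt.mp fun h => h2 ⟨h, hω⟩
      simpa [hω] using this
    · simpa [hω] using h0
  filter_upwards [h3] with ω h3 hc
  by_contra hcon
  have hω : ω ∈ s := ⟨hc, not_lt.mp hcon⟩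
  rw [Set.piecewise_eq_of_mem _ _ _ hω] at h3
  exact absurd hc (not_lt.mpr h3)

/-- Conditional probabilities of events that decrease to a null event become arbitrarily small. -/
lemma ae_exists_condProb_lt (hG : G ≤ mΩ) {E : ℕ → Set Ω} (hE : ∀ m, MeasurableSet (E m))
    (hanti : Antitone E) (h0 : P (⋂ m, E m) = 0) :
    ∀ᵐ ω ∂P, ∀ ε > 0, ∃ m, (P⟦E m|G⟧) ω < ε := by
  have hj : ∀ j : ℕ, ∀ᵐ ω ∂P, ∃ m, (P⟦E m|G⟧) ω < 1 / ((j : ℝ) + 1) := by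
    intro j
    set δ : ℝ := 1 / ((j : ℝ) + 1)
    have hδ : 0 < δ := by positivity
    -- On the exceptional set all the conditional probabilities are at least `δ`, so `δ * P.real s`
    -- is at most `P.real (E m)`, which tends to `0`.
    set s : Set Ω := ⋂ m, {ω | δ ≤ (P⟦E m|G⟧) ω}
    have hs : MeasurableSet[G] s := MeasurableSet.iInter fun m =>
      stronglyMeasurable_condExp.measurable measurableSet_Ici
    have hle : ∀ m, δ * P.real s ≤ P.real (E m) := by
      intro m
      calc δ * P.real s = ∫ _ in s, δ ∂P := by simp [mul_comm]
        _ ≤ ∫ ω in s, (P⟦E m|G⟧) ω ∂P :=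
          setIntegral_mono_on (integrable_const _) integrable_condExp.integrableOn (hG _ hs)
            fun ω hω => Set.mem_iInter.mp hω m
        _ = P.real (E m ∩ s) := setIntegral_condProb hG (hE m) hs
        _ ≤ P.real (E m) := measureReal_mono Set.inter_subset_left
    have hlim : Tendsto (fun m => P.real (E m)) atTop (𝓝 0) := by
      have := tendsto_measure_iInter_atTop (μ := P) (fun m => (hE m).nullMeasurableSet) hanti
        ⟨0, measure_ne_top _ _⟩
      rw [h0] at this
      simpa [measureReal_def, Function.comp_def] using
        (ENNReal.tendsto_toReal ENNReal.zero_ne_top).comp this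
    have h1 : δ * P.real s ≤ 0 := ge_of_tendsto' hlim hle
    have h2 : P.real s = 0 := le_antisymm (nonpos_of_mul_nonpos_right h1 hδ) measureReal_nonneg
    filter_upwards [measure_eq_zero_iff_ae_notMem.mp ((measureReal_eq_zero_iff).mp h2)] with ω hω
    simpa [s] using hω
  filter_upwards [ae_all_iff.mpr hj] with ω hω ε hε
  obtain ⟨j, hjε⟩ := exists_nat_one_div_lt hε
  obtain ⟨m, hm⟩ := hω j
  exact ⟨m, hm.trans hjε⟩

end CondProb

/-! ### Deterministic estimates for order statistics and near-maxima counts. -/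

section OrderStat

lemma exists_orderStat_eq (x : ℕ → ℝ) {k n : ℕ} (hk : 1 ≤ k ∧ k ≤ n) :
    ∃ i, orderStat x k n = x i := by
  rw [orderStat, dif_pos hk]
  exact ⟨_, rfl⟩

lemma lt_orderStat_of_lt_card (x : ℕ → ℝ) {k n : ℕ} (hk : 1 ≤ k ∧ k ≤ n) {c : ℝ}
    (h : n < k + ((Finset.range n).filter fun i => c < x i).card) : c < orderStat x k n := by
  by_contra hcon
  set σ := Tuple.sort (fun i : Fin n => x i)
  have hc : x (σ ⟨k - 1, by omega⟩) ≤ c := by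
    rw [orderStat, dif_pos hk] at hcon
    exact not_lt.mp hcon
  -- The sorted positions `0, …, k - 1` carry values at most the `k`-th order statistic, hence at
  -- most `c`. This leaves at most `n - k` terms above `c`.
  have hcard : k ≤ ((Finset.range n).filter fun i => ¬ c < x i).card := by
    have := Finset.card_le_card_of_injOn (s := (Finset.univ : Finset (Fin k)))
      (t := (Finset.range n).filter fun i => ¬ c < x i)
      (fun j => ((σ (Fin.castLE hk.2 j) : Fin n) : ℕ)) ?_ ?_
    · simpa using this
    · intro j _
      have hj : Fin.castLE hk.2 j ≤ ⟨k - 1, by omega⟩ := by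
        rw [Fin.le_def]; simp; omega
      have := (Tuple.monotone_sort (fun i : Fin n => x i)) hj
      simpa using this.trans hc
    · intro i _ j _ hij
      exact Fin.castLE_injective hk.2 (σ.injective (Fin.ext hij))
  have := Finset.card_filter_add_card_filter_not (s := Finset.range n) (fun i => c < x i)
  rw [Finset.card_range] at this
  omega

open Classical in
/-- The relative frequency of a property among the first `n` natural numbers. -/
def freq (p : ℕ → Prop) (n : ℕ) : ℝ := (((Finset.range n).filter p).card : ℝ) / (n : ℝ)

lemma freq_nonneg (p : ℕ → Prop) (n : ℕ) : 0 ≤ freq p n := by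
  unfold freq; positivity

lemma freq_le_add {p q r : ℕ → Prop} (h : ∀ i, p i → q i ∨ r i) (n : ℕ) :
    freq p n ≤ freq q n + freq r n := by
  classical
  unfold freq
  rw [← add_div]
  gcongr
  norm_cast
  refine (Finset.card_le_card fun i hi => ?_).trans (Finset.card_union_le _ _)
  simp only [Finset.mem_union, Finset.mem_filter] at hi ⊢
  have := h i hi.2
  tauto

lemma freq_mono {p q : ℕ → Prop} (h : ∀ i, p i → q i) (n : ℕ) : freq p n ≤ freq q n := by
  classical
  unfold freq
  gcongr with i
  exact h i

lemma nearCount_div_eq_freq (x : ℕ → ℝ) (k n : ℕ) (a : ℝ) :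
    (nearCount x k n a : ℝ) / (n : ℝ)
      = freq (fun i => orderStat x k n - a < x i ∧ x i < orderStat x k n) n := by
  unfold freq nearCount
  congr!

variable {x : ℕ → ℝ} {k : ℕ → ℕ}

/-- The sum of `k n / n` and the frequency of exceeding `c` tends to `1 + δ > 1`, so the counting
criterion `lt_orderStat_of_lt_card` eventually applies. -/
lemma eventually_lt_orderStat (hk : ∀ n, 1 ≤ n → 1 ≤ k n ∧ k n ≤ n)
    (hk1 : Tendsto (fun n : ℕ => (k n : ℝ) / (n : ℝ)) atTop (𝓝 1)) {c δ : ℝ} (hδ : 0 < δ)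
    (h : Tendsto (freq fun i => c < x i) atTop (𝓝 δ)) :
    ∀ᶠ n in atTop, c < orderStat x (k n) n := by
  have h1 := (hk1.add h).eventually_const_lt (show (1 : ℝ) < 1 + δ by linarith)
  filter_upwards [h1, eventually_ge_atTop 1] with n h1 hn
  refine lt_orderStat_of_lt_card x (hk n hn) ?_
  have hn' : (0 : ℝ) < n := by exact_mod_cast hn
  unfold freq at h1
  rw [← add_div, lt_div_iff₀ hn', one_mul] at h1
  have h2 : (n : ℝ) < ((k n + ((Finset.range n).filter fun i => c < x i).card : ℕ) : ℝ) := by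
    push_cast
    convert h1
  exact_mod_cast h2

/-- Once the order statistic exceeds `m + a`, every counted term exceeds `m`. -/
lemma tendsto_nearCount_of_unbounded {a : ℝ} (hM : ∀ c : ℝ, ∀ᶠ n in atTop, c < orderStat x (k n) n)
    {L : ℕ → ℝ} (hL : ∀ m : ℕ, Tendsto (freq fun i => (m : ℝ) < x i) atTop (𝓝 (L m)))
    (hL0 : ∀ ε > 0, ∃ m, L m < ε) :
    Tendsto (fun n : ℕ => (nearCount x (k n) n a : ℝ) / (n : ℝ)) atTop (𝓝 0) := by
  rw [Metric.tendsto_nhds]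
  intro ε hε
  obtain ⟨m, hm⟩ := hL0 ε hε
  filter_upwards [hM (m + a), (hL m).eventually_lt_const hm] with n h1 h2
  rw [nearCount_div_eq_freq, dist_zero_right, Real.norm_eq_abs, abs_of_nonneg (freq_nonneg _ _)]
  exact (freq_mono (fun i hi => by linarith [hi.1]) n).trans_lt h2

/-- A sandwich: `r` is the upper bound, and `L`, `L'` are the limiting frequencies of short windows
ending at `r` and at `r - a`. The shape `0 + …`, `x i + 0` makes both windows instances of one
family, with offsets `0` and `a`. -/
lemma tendsto_nearCount_of_bounded {a r p : ℝ}
    (hk : ∀ n, 1 ≤ n → 1 ≤ k n ∧ k n ≤ n) (hx : ∀ i, x i ≤ r)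
    (hM : ∀ c < r, ∀ᶠ n in atTop, c < orderStat x (k n) n)
    (hp : Tendsto (freq fun i => r < x i + a) atTop (𝓝 p)) {L L' : ℕ → ℝ}
    (hL : ∀ m : ℕ, Tendsto (freq fun i => r < x i + (0 + 1 / ((m : ℝ) + 1)) ∧ x i + 0 ≤ r)
      atTop (𝓝 (L m)))
    (hL' : ∀ m : ℕ, Tendsto (freq fun i => r < x i + (a + 1 / ((m : ℝ) + 1)) ∧ x i + a ≤ r)
      atTop (𝓝 (L' m)))
    (hL0 : ∀ ε > 0, ∃ m, L m < ε) (hL0' : ∀ ε > 0, ∃ m, L' m < ε) :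
    Tendsto (fun n : ℕ => (nearCount x (k n) n a : ℝ) / (n : ℝ)) atTop (𝓝 p) := by
  rw [Metric.tendsto_nhds]
  intro ε hε
  obtain ⟨m, hm⟩ := hL0 (ε / 2) (half_pos hε)
  obtain ⟨m', hm'⟩ := hL0' (ε / 2) (half_pos hε)
  have hpos : ∀ j : ℕ, (0 : ℝ) < 1 / ((j : ℝ) + 1) := fun j => by positivity
  filter_upwards [hM (r - 1 / ((m : ℝ) + 1)) (by linarith [hpos m]),
    hM (r - 1 / ((m' : ℝ) + 1)) (by linarith [hpos m']), eventually_ge_atTop 1,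
    (hL m).eventually_lt_const hm, (hL' m').eventually_lt_const hm',
    hp.eventually_lt_const (show p < p + ε / 2 by linarith),
    hp.eventually_const_lt (show p - ε / 2 < p by linarith)] with n h1 h2 hn h3 h4 h5 h6
  rw [nearCount_div_eq_freq]
  have hMr : orderStat x (k n) n ≤ r := by
    obtain ⟨i, hi⟩ := exists_orderStat_eq x (hk n hn)
    rw [hi]; exact hx i
  set M := orderStat x (k n) n
  -- A counted term not above `r - a` lies just below it, because the order statistic is within `1 /
  -- (m' + 1)` of `r`.
  have h7 : freq (fun i => M - a < x i ∧ x i < M) n ≤ _ := freq_le_add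
    (q := fun i => r < x i + a)
    (r := fun i => r < x i + (a + 1 / ((m' : ℝ) + 1)) ∧ x i + a ≤ r) (fun i hi => by
      rcases lt_or_ge r (x i + a) with h | h
      · exact Or.inl h
      · exact Or.inr ⟨by linarith [hi.1], h⟩) n
  -- A term above `r - a` that is not counted is at least the order statistic, hence within `1 / (m
  -- + 1)` of `r`.
  have h8 : freq (fun i => r < x i + a) n ≤ _ := freq_le_add
    (q := fun i => M - a < x i ∧ x i < M)
    (r := fun i => r < x i + (0 + 1 / ((m : ℝ) + 1)) ∧ x i + 0 ≤ r) (fun i hi => by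
      rcases lt_or_ge (x i) M with h | h
      · exact Or.inl ⟨by linarith, h⟩
      · exact Or.inr ⟨by linarith, by linarith [hx i]⟩) n
  rw [Real.dist_eq, abs_lt]
  constructor <;> linarith

end OrderStat

/-! ### Almost sure limits of the near-maxima proportions. -/

section Main

variable {Ω : Type*} [MeasurableSpace Ω] {P : Measure Ω} [IsProbabilityMeasure P]
  {X : ℕ → Ω → ℝ} {γ : Ω → EReal} {k : ℕ → ℕ}

lemma ae_tendsto_freq_lt (hX : ∀ i, Measurable (X i)) (hstat : StrictlyStationary P X) (c : ℝ) :
    ∀ᵐ ω ∂P, Tendsto (freq fun i => c < X i ω) atTop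
      (𝓝 ((P⟦{ω' | c < X 0 ω'}|invariantSigma X⟧) ω)) :=
  -- The set constrains only the second coordinate, so any constant can serve as the invariant
  -- variable.
  ae_tendsto_frequency hX hstat (γ := fun _ => 0) measurable_const (R := {z | c < z.2})
    (measurableSet_lt measurable_const measurable_snd)

lemma measurableSet_lt_add (b : ℝ) :
    MeasurableSet {z : EReal × ℝ | z.1 < ((z.2 + b : ℝ) : EReal)} :=
  measurableSet_lt measurable_fst (measurable_snd.add_const b).coe_real_ereal

/-- A window just below `γ - b` is rarely visited if `γ - b` is not an atom. -/
lemma ae_window_freq (hX : ∀ i, Measurable (X i)) (hstat : StrictlyStationary P X)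
    (hγ : Measurable[invariantSigma X] γ) (b : ℝ)
    (h0 : P {ω | ((X 0 ω + b : ℝ) : EReal) = γ ω} = 0) :
    ∀ᵐ ω ∂P, ∃ L : ℕ → ℝ, (∀ m : ℕ, Tendsto
      (freq fun i => γ ω < ((X i ω + (b + 1 / ((m : ℝ) + 1)) : ℝ) : EReal) ∧
        ((X i ω + b : ℝ) : EReal) ≤ γ ω) atTop (𝓝 (L m))) ∧ ∀ ε > 0, ∃ m, L m < ε := by
  have hG := invariantSigma_le hX
  set R : ℕ → Set (EReal × ℝ) := fun m =>
    {z | z.1 < ((z.2 + (b + 1 / ((m : ℝ) + 1)) : ℝ) : EReal) ∧ ((z.2 + b : ℝ) : EReal) ≤ z.1}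
  have hR : ∀ m, MeasurableSet (R m) := fun m => (measurableSet_lt_add _).inter
    (measurableSet_le (measurable_snd.add_const b).coe_real_ereal measurable_fst)
  set E : ℕ → Set Ω := fun m => {ω | (γ ω, X 0 ω) ∈ R m}
  have hE : ∀ m, MeasurableSet (E m) := fun m =>
    ((hγ.mono hG le_rfl).prodMk (hX 0)) (hR m)
  have hanti : Antitone E := by
    rintro m m' hmm ω ⟨h1, h2⟩
    refine ⟨h1.trans_le ?_, h2⟩
    have := Nat.one_div_le_one_div (α := ℝ) hmm
    exact EReal.coe_le_coe_iff.mpr (add_le_add le_rfl (add_le_add le_rfl this))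
  -- The windows shrink to the event `X 0 + b = γ`, which is null by hypothesis.
  have hnull : P (⋂ m, E m) = 0 := by
    refine measure_mono_null (fun ω hω => ?_) h0
    have h1 : ∀ m, (γ ω, X 0 ω) ∈ R m := fun m => Set.mem_iInter.mp hω m
    refine le_antisymm (h1 0).2 (not_lt.mp fun hlt => ?_)
    obtain ⟨c, hc1, hc2⟩ := EReal.lt_iff_exists_real_btwn.mp hlt
    have hc1' : X 0 ω + b < c := by exact_mod_cast hc1
    obtain ⟨m, hm⟩ := exists_nat_one_div_lt (sub_pos.mpr hc1')
    have h2 : (c : EReal) < ((X 0 ω + (b + 1 / ((m : ℝ) + 1)) : ℝ) : EReal) := hc2.trans (h1 m).1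
    have h3 : c < X 0 ω + (b + 1 / ((m : ℝ) + 1)) := by exact_mod_cast h2
    linarith
  filter_upwards [ae_all_iff.mpr fun m => ae_tendsto_frequency hX hstat hγ (hR m),
    ae_exists_condProb_lt hG hE hanti hnull] with ω h1 h2
  exact ⟨_, h1, h2⟩

/-- The order statistics eventually exceed every number below the conditional right endpoint. -/
lemma ae_eventually_lt_orderStat (hX : ∀ i, Measurable (X i)) (hstat : StrictlyStationary P X)
    (hk : ∀ n, 1 ≤ n → 1 ≤ k n ∧ k n ≤ n)
    (hk1 : Tendsto (fun n : ℕ => (k n : ℝ) / (n : ℝ)) atTop (𝓝 1))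
    (hγ : IsCondRightEndpoint (invariantSigma X) P (X 0) γ) :
    ∀ᵐ ω ∂P, ∀ c : ℝ, (c : EReal) < γ ω →
      ∀ᶠ n in atTop, c < orderStat (fun i => X i ω) (k n) n := by
  -- Rational levels keep the exceptional set null; a real `c < γ ω` is handled by a rational
  -- strictly between.
  filter_upwards [ae_all_iff.mpr fun q : ℚ => ae_tendsto_freq_lt hX hstat (q : ℝ),
    ae_all_iff.mpr fun q : ℚ => hγ.ae_condProb_pos (invariantSigma_le hX) (hX 0) (q : ℝ)]
    with ω h1 h2 c hc
  obtain ⟨q, hq1, hq2⟩ := EReal.lt_iff_exists_rat_btwn.mp hc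
  have hq1' : c < q := by exact_mod_cast hq1
  filter_upwards [eventually_lt_orderStat hk hk1 (h2 q hq2) (h1 q)] with n hn
  exact hq1'.trans hn

/-- Where the conditional right endpoint is infinite, near-maxima are asymptotically negligible. -/
lemma ae_tendsto_nearCount_of_eq_top (hX : ∀ i, Measurable (X i)) (hstat : StrictlyStationary P X)
    (hk : ∀ n, 1 ≤ n → 1 ≤ k n ∧ k n ≤ n)
    (hk1 : Tendsto (fun n : ℕ => (k n : ℝ) / (n : ℝ)) atTop (𝓝 1))
    (hγ : IsCondRightEndpoint (invariantSigma X) P (X 0) γ) (a : ℝ) :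
    ∀ᵐ ω ∂P, γ ω = ⊤ → Tendsto
      (fun n : ℕ => (nearCount (fun i => X i ω) (k n) n a : ℝ) / (n : ℝ)) atTop (𝓝 0) := by
  have hanti : Antitone fun m : ℕ => {ω' | (m : ℝ) < X 0 ω'} := fun m m' hmm ω hω =>
    lt_of_le_of_lt (by exact_mod_cast hmm) (Set.mem_ofPred_eq ▸ hω)
  have hnull : P (⋂ m : ℕ, {ω' | (m : ℝ) < X 0 ω'}) = 0 := by
    have : ⋂ m : ℕ, {ω' | (m : ℝ) < X 0 ω'} = ∅ := by
      refine Set.eq_empty_of_forall_notMem fun ω hω => ?_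
      obtain ⟨m, hm⟩ := exists_nat_gt (X 0 ω)
      exact lt_asymm hm (Set.mem_iInter.mp hω m)
    rw [this, measure_empty]
  filter_upwards [ae_eventually_lt_orderStat hX hstat hk hk1 hγ,
    ae_all_iff.mpr fun m : ℕ => ae_tendsto_freq_lt hX hstat (m : ℝ),
    ae_exists_condProb_lt (invariantSigma_le hX)
      (fun m : ℕ => measurableSet_lt measurable_const (hX 0)) hanti hnull] with ω h1 h2 h3 htop
  exact tendsto_nearCount_of_unbounded (fun c => h1 c (by rw [htop]; exact EReal.coe_lt_top c))
    h2 h3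

/-- Where the conditional right endpoint is finite, the proportion of near-maxima converges to the
conditional probability of exceeding the right endpoint minus `a`. -/
lemma ae_tendsto_nearCount_of_lt_top (hX : ∀ i, Measurable (X i)) (hstat : StrictlyStationary P X)
    (hk : ∀ n, 1 ≤ n → 1 ≤ k n ∧ k n ≤ n)
    (hk1 : Tendsto (fun n : ℕ => (k n : ℝ) / (n : ℝ)) atTop (𝓝 1))
    (hγ : IsCondRightEndpoint (invariantSigma X) P (X 0) γ) {a : ℝ}
    (h0 : P {ω | (X 0 ω : EReal) = γ ω} = 0)
    (h0' : P {ω | (X 0 ω : EReal) = γ ω - (a : EReal)} = 0) :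
    ∀ᵐ ω ∂P, γ ω < ⊤ → Tendsto
      (fun n : ℕ => (nearCount (fun i => X i ω) (k n) n a : ℝ) / (n : ℝ)) atTop
      (𝓝 ((P⟦{ω' | γ ω' - (a : EReal) < (X 0 ω' : EReal)}|invariantSigma X⟧) ω)) := by
  have hG := invariantSigma_le hX
  have hle : ∀ᵐ ω ∂P, ∀ i, (X i ω : EReal) ≤ γ ω :=
    ae_le_of_ae_zero_le hX hstat hγ.measurable <|
      (condProb_eq_one_iff P hG (measurableSet_le (hX 0).coe_real_ereal
        (hγ.measurable.mono hG le_rfl))).mp hγ.condProb_eq_one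
  have hw := ae_window_freq hX hstat hγ.measurable 0 (by simpa using h0)
  have hw' := ae_window_freq hX hstat hγ.measurable a <| by
    refine measure_mono_null (fun ω hω => ?_) h0'
    have hω' : ((X 0 ω + a : ℝ) : EReal) = γ ω := hω
    rw [Set.mem_ofPred_eq, ← hω', ← EReal.coe_sub]
    simp
  -- Moving `a` to the real side avoids extended subtraction. At `γ = ⊤` both conditions fail and at
  -- `γ = ⊥` both hold.
  have hset : {ω' | γ ω' - (a : EReal) < (X 0 ω' : EReal)}
      = {ω' | (γ ω', X 0 ω') ∈ {z : EReal × ℝ | z.1 < ((z.2 + a : ℝ) : EReal)}} := by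
    ext ω
    simp only [Set.mem_ofPred_eq]
    induction γ ω using EReal.rec with
    | bot => simp
    | top => simp
    | coe r =>
      rw [← EReal.coe_sub, EReal.coe_lt_coe_iff, EReal.coe_lt_coe_iff, sub_lt_iff_lt_add]
  rw [hset]
  filter_upwards [ae_eventually_lt_orderStat hX hstat hk hk1 hγ, hle, hw, hw',
    ae_tendsto_frequency hX hstat hγ.measurable (measurableSet_lt_add a)]
    with ω hM hle hw hw' hp hfin
  obtain ⟨L, hL, hL0⟩ := hw
  obtain ⟨L', hL', hL0'⟩ := hw'
  have hbot : γ ω ≠ ⊥ := fun h => by simpa [h] using hle 0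
  obtain ⟨r, hr⟩ : ∃ r : ℝ, γ ω = r := ⟨_, (EReal.coe_toReal hfin.ne hbot).symm⟩
  simp only [hr, EReal.coe_lt_coe_iff, EReal.coe_le_coe_iff] at hM hle hL hL'
  refine tendsto_nearCount_of_bounded hk hle hM ?_ hL hL' hL0 hL0'
  simp only [hr, EReal.coe_lt_coe_iff] at hp
  exact hp

end Main

end NearMax

end

theorem theorem3p4 {Ω : Type*} [MeasurableSpace Ω] (P : Measure Ω) [IsProbabilityMeasure P]
    (X : ℕ → Ω → ℝ) (hX : ∀ i, Measurable (X i)) (hstat : NearMax.StrictlyStationary P X)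
    (k : ℕ → ℕ) (hk : ∀ n, 1 ≤ n → 1 ≤ k n ∧ k n ≤ n)
    (hk1 : Tendsto (fun n : ℕ => (k n : ℝ) / (n : ℝ)) atTop (𝓝 1))
    (a : ℝ) (ha : 0 < a)
    (γ : Ω → EReal)
    (hγ : NearMax.IsCondRightEndpoint (NearMax.invariantSigma X) P (X 0) γ) :
    (P {ω | (X 0 ω : EReal) = γ ω} = 0 →
      P {ω | (X 0 ω : EReal) = γ ω - (a : EReal)} = 0 →
      (∀ᵐ ω ∂P, Tendsto
          (fun n : ℕ => (NearMax.nearCount (fun i => X i ω) (k n) n a : ℝ) / (n : ℝ)) atTop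
          (𝓝 ({ω' | γ ω' < ⊤}.indicator (fun _ => (1 : ℝ)) ω *
            (P⟦{ω' | γ ω' - (a : EReal) < (X 0 ω' : EReal)} | NearMax.invariantSigma X⟧) ω))) ∧
      (∀ᵐ ω ∂P, γ ω = ⊤ → Tendsto
          (fun n : ℕ => (NearMax.nearCount (fun i => X i ω) (k n) n a : ℝ) / (n : ℝ)) atTop
          (𝓝 0))) ∧
    ((∀ᵐ ω ∂P, γ ω = ⊤) → ∀ᵐ ω ∂P, Tendsto
      (fun n : ℕ => (NearMax.nearCount (fun i => X i ω) (k n) n a : ℝ) / (n : ℝ)) atTop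
      (𝓝 0)) := by
  -- The case `γ = ⊤` needs no condition on atoms, so it serves both claims.
  have htop := NearMax.ae_tendsto_nearCount_of_eq_top hX hstat hk hk1 hγ a
  refine ⟨fun h0 h0' => ⟨?_, htop⟩, fun h => ?_⟩
  · filter_upwards [htop, NearMax.ae_tendsto_nearCount_of_lt_top hX hstat hk hk1 hγ h0 h0']
      with ω h1 h2
    by_cases hω : γ ω < ⊤
    · rw [Set.indicator_of_mem (by exact hω), one_mul]
      exact h2 hω
    · rw [Set.indicator_of_notMem (by exact hω), zero_mul]
      exact h1 (not_lt_top_iff.mp hω)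
  · filter_upwards [htop, h] with ω h1 h2
    exact h1 h2
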